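/- Let $\mathbb K$ be a field. A (multiplicative) Hom-Lie algebra $(L,\alpha_L)$ over $\mathbb K$ is a $\mathbb K$-vector space $L$ with a bilinear alternating bracket ($[x,x]=0$; when $\operatorname{char}\mathbb K\neq 2$ this is the same as skew-symmetry $[x,y]=-[y,x]$) and a linear map $\alpha_L\colon L\to L$ such that $\alpha_L[x,y]=[\alpha_L(x),\alpha_L(y)]$ and $[\alpha_L(x),[y,z]]+[\alpha_L(z),[x,y]]+[\alpha_L(y),[z,x]]=0$ for all $x,y,z\in L$. Isomorphisms are linear bijections that preserve brackets and twists. The centre of $(H,\alpha_H)$ is the ideal $Z(H)=\{x\in H\mid [\alpha_H^k(x),y]=0 \text{ for all } y\in H,\ k\geq 0\}$, and $(L,\alpha_L)$ is called capable if $L\cong H/Z(H)$ for some Hom-Lie algebra $(H,\alpha_H)$ over $\mathbb K$, where $H/Z(H)$ carries the induced bracket and twist. The non-abelian tensor square $L\star L$ is the quotient of $L\otimes_{\mathbb K} L$ by the subspace spanned by all elements (a) $[m,m']\otimes\alpha(n)-\alpha(m)\otimes[m',n]+\alpha(m')\otimes[m,n]$, (b) $\alpha(m)\otimes[n,n']-[n',m]\otimes\alpha(n)+[n,m]\otimes\alpha(n')$,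 (c) $[n,m]\otimes[m,n]$, (d) $[n,m]\otimes[m',n']+[n',m']\otimes[m,n]$, (e) $[[n,m],[n',m']]\otimes\alpha([m'',n''])+[[n',m'],[n'',m'']]\otimes\alpha([m,n])+[[n'',m''],[n,m]]\otimes\alpha([m',n'])$, where $\alpha=\alpha_L$ and $m,m',m'',n,n',n''\in L$. The non-abelian exterior square $L\curlywedge L$ is the quotient of $L\star L$ by the subspace spanned by the classes of all $m\otimes m$, $m\in L$, and $m\curlywedge n$ denotes the class of $m\otimes n$. The exterior centre of $(L,\alpha_L)$ is $$Z_\alpha^{\curlywedge}(L)=\{\,l\in L\mid \alpha_L^k(l)\curlywedge x=0\ \text{ for all } x\in L,\ k\geq 0\,\}.$$ Theorem. A Hom-Lie algebra $(L,\alpha_L)$ is capable if and only if $Z_\alpha^{\curlywedge}(L)=0$. -/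

import Mathlib

open scoped TensorProduct

universe w v u

/-- A (multiplicative) Hom-Lie algebra structure on a vector space `L` over a field `K`.
The bracket is required to be alternating, `[x, x] = 0`; this implies `[x, y] = -[y, x]`
(`HomLieAlgebra.skew`) and is equivalent to it when `2 ≠ 0` in `K`
(`HomLieAlgebra.self_eq_zero_of_skew`).  For `twist = id` one gets exactly the Lie algebras over
`K`, in every characteristic. -/
structure HomLieAlgebra (K L : Type*) [Field K] [AddCommGroup L] [Module K L] where
  bracket : L →ₗ[K] L →ₗ[K] L
  twist : L →ₗ[K] L
  bracket_self : ∀ x, bracket x x = 0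
  hom_jacobi : ∀ x y z, bracket (twist x) (bracket y z) + bracket (twist z) (bracket x y)
    + bracket (twist y) (bracket z x) = 0
  twist_bracket : ∀ x y, twist (bracket x y) = bracket (twist x) (twist y)

namespace HomLieAlgebra

section Basic

variable {K L : Type*} [Field K] [AddCommGroup L] [Module K L] (S : HomLieAlgebra K L)

theorem skew (x y : L) : S.bracket x y = - S.bracket y x := by
  have h := S.bracket_self (x + y)
  simp only [map_add, LinearMap.add_apply, S.bracket_self, zero_add, add_zero] at h
  exact eq_neg_of_add_eq_zero_right h

theorem self_eq_zero_of_skew (h2 : (2 : K) ≠ 0) (b : L →ₗ[K] L →ₗ[K] L)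
    (hb : ∀ x y, b x y = - b y x) (x : L) : b x x = 0 := by
  have h : (2 : K) • b x x = 0 := by
    rw [two_smul]
    exact eq_neg_iff_add_eq_zero.mp (hb x x)
  exact (smul_eq_zero.mp h).resolve_left h2

theorem twist_iterate_bracket (k : ℕ) (x y : L) :
    S.twist^[k] (S.bracket x y) = S.bracket (S.twist^[k] x) (S.twist^[k] y) := by
  induction k generalizing x y with
  | zero => rfl
  | succ k ih => simp only [Function.iterate_succ_apply, S.twist_bracket, ih]

/-- An ideal of a Hom-Lie algebra: a subspace which is stable under the twist and under brackets
with arbitrary elements. -/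
structure Ideal extends Submodule K L where
  twist_mem : ∀ {x}, x ∈ carrier → S.twist x ∈ carrier
  bracket_mem : ∀ {x}, x ∈ carrier → ∀ y, S.bracket x y ∈ carrier

/-- The centre `Z(L) = {x | [α^k(x), y] = 0 for all y and all k ≥ 0}`. -/
def center : S.Ideal where
  carrier := {x | ∀ (k : ℕ) (y : L), S.bracket (S.twist^[k] x) y = 0}
  add_mem' := by
    intro a b ha hb k y
    rw [iterate_map_add, map_add, LinearMap.add_apply, ha k y, hb k y, add_zero]
  zero_mem' := by
    intro k y
    rw [iterate_map_zero, map_zero, LinearMap.zero_apply]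
  smul_mem' := by
    intro c x hx k y
    have h : S.twist^[k] (c • x) = c • S.twist^[k] x := by
      simp only [← Module.End.pow_apply, map_smul]
    rw [h, map_smul, LinearMap.smul_apply, hx k y, smul_zero]
  twist_mem := by
    intro x hx k y
    rw [← Function.iterate_succ_apply]
    exact hx (k + 1) y
  bracket_mem := by
    intro x hx z k y
    rw [S.twist_iterate_bracket, hx k, map_zero, LinearMap.zero_apply]

/-- The quotient Hom-Lie algebra `L / I`, with
`[x + I, y + I] = [x, y] + I` and twist `x + I ↦ α(x) + I`. -/
def quotient (I : S.Ideal) : HomLieAlgebra K (L ⧸ I.toSubmodule) where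
  bracket := I.toSubmodule.liftQ
    (LinearMap.flip (I.toSubmodule.liftQ
      (LinearMap.flip (S.bracket.compr₂ I.toSubmodule.mkQ)) (by
        intro y hy
        ext x
        simp only [LinearMap.flip_apply, LinearMap.compr₂_apply, LinearMap.zero_apply,
          Submodule.mkQ_apply, Submodule.Quotient.mk_eq_zero]
        rw [S.skew]
        exact I.toSubmodule.neg_mem (I.bracket_mem hy x)))) (by
    intro x hx
    ext y
    exact (Submodule.Quotient.mk_eq_zero _).mpr (I.bracket_mem hx y))
  twist := I.toSubmodule.mapQ I.toSubmodule S.twist (fun _ hx => I.twist_mem hx)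
  bracket_self := by
    intro x
    obtain ⟨x, rfl⟩ := Submodule.Quotient.mk_surjective _ x
    exact congrArg Submodule.Quotient.mk (S.bracket_self x)
  hom_jacobi := by
    intro x y z
    obtain ⟨x, rfl⟩ := Submodule.Quotient.mk_surjective _ x
    obtain ⟨y, rfl⟩ := Submodule.Quotient.mk_surjective _ y
    obtain ⟨z, rfl⟩ := Submodule.Quotient.mk_surjective _ z
    exact congrArg Submodule.Quotient.mk (S.hom_jacobi x y z)
  twist_bracket := by
    intro x y
    obtain ⟨x, rfl⟩ := Submodule.Quotient.mk_surjective _ x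
    obtain ⟨y, rfl⟩ := Submodule.Quotient.mk_surjective _ y
    exact congrArg Submodule.Quotient.mk (S.twist_bracket x y)

theorem quotient_bracket_mk (I : S.Ideal) (x y : L) :
    (S.quotient I).bracket (Submodule.Quotient.mk x) (Submodule.Quotient.mk y)
      = Submodule.Quotient.mk (S.bracket x y) := rfl

theorem quotient_twist_mk (I : S.Ideal) (x : L) :
    (S.quotient I).twist (Submodule.Quotient.mk x) = Submodule.Quotient.mk (S.twist x) := rfl

/-- Isomorphism of Hom-Lie algebras: a linear bijection preserving brackets and twists. -/
def Isomorphic {M : Type*} [AddCommGroup M] [Module K M] (T : HomLieAlgebra K M) : Prop :=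
  ∃ e : L ≃ₗ[K] M, (∀ x y, e (S.bracket x y) = T.bracket (e x) (e y)) ∧
    ∀ x, e (S.twist x) = T.twist (e x)

end Basic

/-- `L` is capable if `L ≅ H / Z(H)` for some Hom-Lie algebra `H` (whose underlying set may live in
any universe `max u w` above the universe `u` of `L`). -/
def Capable {K : Type v} {L : Type u} [Field K] [AddCommGroup L] [Module K L]
    (S : HomLieAlgebra K L) : Prop :=
  ∃ (H : Type (max u w)) (_ : AddCommGroup H) (_ : Module K H) (T : HomLieAlgebra K H),
    S.Isomorphic (T.quotient T.center)

/-- A Hom-action `(x, m) ↦ ˣm` of the Hom-Lie algebra `L` on the Hom-Lie algebra `M`. -/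
structure Action {K L M : Type*} [Field K] [AddCommGroup L] [Module K L] [AddCommGroup M]
    [Module K M] (S : HomLieAlgebra K L) (T : HomLieAlgebra K M) where
  act : L →ₗ[K] M →ₗ[K] M
  act_bracket : ∀ x y m, act (S.bracket x y) (T.twist m)
    = act (S.twist x) (act y m) - act (S.twist y) (act x m)
  act_twist_bracket : ∀ x m m', act (S.twist x) (T.bracket m m')
    = T.bracket (act x m) (T.twist m') + T.bracket (T.twist m) (act x m')
  twist_act : ∀ x m, T.twist (act x m) = act (S.twist x) (T.twist m)

/-- A crossed module of Hom-Lie algebras `map : M → L`. -/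
structure CrossedModule {K L M : Type*} [Field K] [AddCommGroup L] [Module K L] [AddCommGroup M]
    [Module K M] (T : HomLieAlgebra K M) (S : HomLieAlgebra K L) extends Action S T where
  map : M →ₗ[K] L
  map_bracket : ∀ m m', map (T.bracket m m') = S.bracket (map m) (map m')
  map_twist : ∀ m, map (T.twist m) = S.twist (map m)
  map_act : ∀ x m, map (act x m) = S.bracket x (map m)
  peiffer : ∀ m m', act (map m) m' = T.bracket m m'

section Products

variable {K L M N : Type*} [Field K] [AddCommGroup L] [Module K L] [AddCommGroup M] [Module K M]
  [AddCommGroup N] [Module K N]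
  {S : HomLieAlgebra K L} {T : HomLieAlgebra K M} {U : HomLieAlgebra K N}

/-- The action of `M` on `N` induced by a crossed module `η : M → L` and an action of `L` on `N`:
`ᵐn = ^{η(m)}n`. -/
def CrossedModule.inducedAction (η : CrossedModule T S) (a : Action S U) : Action T U where
  act := a.act.comp η.map
  act_bracket := by
    intro x y m
    simp only [LinearMap.comp_apply, η.map_bracket, η.map_twist, a.act_bracket]
  act_twist_bracket := by
    intro x m m'
    simp only [LinearMap.comp_apply, η.map_twist, a.act_twist_bracket]
  twist_act := by
    intro x m
    simp only [LinearMap.comp_apply, η.map_twist, a.twist_act]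

/-- The subspace `D(M, N)` of `M ⊗ N`, for Hom-Lie algebras `M`, `N` acting on each other by `a`
(`M` on `N`) and `b` (`N` on `M`). -/
def tensorRelations (a : Action T U) (b : Action U T) : Submodule K (M ⊗[K] N) :=
  Submodule.span K
    ({t | ∃ (m m' : M) (n : N), t = T.bracket m m' ⊗ₜ[K] U.twist n
        - T.twist m ⊗ₜ[K] a.act m' n + T.twist m' ⊗ₜ[K] a.act m n} ∪
     {t | ∃ (m : M) (n n' : N), t = T.twist m ⊗ₜ[K] U.bracket n n'
        - b.act n' m ⊗ₜ[K] U.twist n + b.act n m ⊗ₜ[K] U.twist n'} ∪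
     {t | ∃ (m : M) (n : N), t = b.act n m ⊗ₜ[K] a.act m n} ∪
     {t | ∃ (m m' : M) (n n' : N), t = b.act n m ⊗ₜ[K] a.act m' n'
        + b.act n' m' ⊗ₜ[K] a.act m n} ∪
     {t | ∃ (m m' m'' : M) (n n' n'' : N), t =
        T.bracket (b.act n m) (b.act n' m') ⊗ₜ[K] U.twist (a.act m'' n'')
        + T.bracket (b.act n' m') (b.act n'' m'') ⊗ₜ[K] U.twist (a.act m n)
        + T.bracket (b.act n'' m'') (b.act n m) ⊗ₜ[K] U.twist (a.act m' n')})

/-- (The underlying vector space of) the non-abelian tensor product `M ⋆ N = (M ⊗ N) / D(M, N)`. -/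
abbrev NonabelianTensor (a : Action T U) (b : Action U T) : Type _ :=
  (M ⊗[K] N) ⧸ tensorRelations a b

/-- The element `m ⋆ n`. -/
def star (a : Action T U) (b : Action U T) (m : M) (n : N) : NonabelianTensor a b :=
  Submodule.Quotient.mk (m ⊗ₜ[K] n)

/-- For crossed modules `η : M → L` and `μ : N → L`, the subspace `M □ N` of `M ⋆ N` spanned by the
`m ⋆ n` with `η(m) = μ(n)`; here `M` and `N` act on each other through `L`. -/
def box (η : CrossedModule T S) (μ : CrossedModule U S) :
    Submodule K (NonabelianTensor (η.inducedAction μ.toAction) (μ.inducedAction η.toAction)) :=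
  Submodule.span K {t | ∃ (m : M) (n : N), η.map m = μ.map n ∧ t = star _ _ m n}

/-- (The underlying vector space of) the non-abelian exterior product
`M ⋏ N = (M ⋆ N) / (M □ N)` of two crossed modules `M → L`, `N → L`. -/
abbrev ExteriorProduct (η : CrossedModule T S) (μ : CrossedModule U S) : Type _ :=
  NonabelianTensor (η.inducedAction μ.toAction) (μ.inducedAction η.toAction) ⧸ box η μ

/-- The element `m ⋏ n`. -/
def curlyWedge (η : CrossedModule T S) (μ : CrossedModule U S) (m : M) (n : N) :
    ExteriorProduct η μ :=
  Submodule.Quotient.mk (star _ _ m n)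

variable (S) in
/-- The crossed module `id : L → L`, where `L` acts on itself by its bracket. -/
def idCrossedModule : CrossedModule S S where
  act := S.bracket
  act_bracket := by
    intro x y m
    have h := S.hom_jacobi x y m
    rw [S.skew (S.twist m), S.skew m x, map_neg] at h
    rw [← sub_eq_zero, ← neg_eq_zero, ← h]
    abel
  act_twist_bracket := by
    intro x m m'
    have h := S.hom_jacobi x m m'
    rw [S.skew (S.twist m'), S.skew m' x, map_neg] at h
    rw [← sub_eq_zero, ← h]
    abel
  twist_act := S.twist_bracket
  map := LinearMap.id
  map_bracket := fun _ _ => rfl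
  map_twist := fun _ => rfl
  map_act := fun _ _ => rfl
  peiffer := fun _ _ => rfl

variable (S) in
/-- The exterior centre of `L`: the set of all `l` such that `α^k(l) ⋏ x = 0` in the exterior
square `L ⋏ L`, for all `x` and all `k ≥ 0`. -/
def exteriorCenter : Set L :=
  {l | ∀ (k : ℕ) (x : L), curlyWedge S.idCrossedModule S.idCrossedModule (S.twist^[k] l) x = 0}

end Products

end HomLieAlgebra

/-! The exterior square is universal for alternating bilinear maps `f` on `L` that satisfy the
Hom-Jacobi identity with respect to the bracket of `L`: all five families of tensor relations follow
from these two conditions (`IsExteriorPairing.tensorRelations_le_ker`). If `L = H / Z(H)`, the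
bracket of `H` descends to such a pairing on `L` with values in `H`. A class `l` in the exterior
centre is therefore killed by it together with all its twists, so its representatives lie in `Z(H)`
and `l = 0`. Conversely, put on `(L ⋏ L) × L` the bracket `[h, h'] = (p h ⋏ p h', 0)`, where `p (s,
x) = c s + x` and `c` is the commutator map. Then `p` is a surjective morphism onto `L`, and `h` is
central exactly when `p h` lies in the exterior centre. If that is zero, `ker p` is the centre. -/

namespace HomLieAlgebra

/-! ### The universal property of the exterior square -/

section ExteriorSquare

variable {K L M : Type*} [Field K] [AddCommGroup L] [Module K L] [AddCommGroup M] [Module K M]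
  (S : HomLieAlgebra K L)

/-- The underlying vector space of the exterior square `L ⋏ L`. -/
abbrev ExteriorSquare : Type _ := ExteriorProduct S.idCrossedModule S.idCrossedModule

/-- The bilinear map `(x, y) ↦ x ⋏ y`. -/
def wedge : L →ₗ[K] L →ₗ[K] S.ExteriorSquare :=
  (TensorProduct.mk K L L).compr₂
    ((box S.idCrossedModule S.idCrossedModule).mkQ ∘ₗ Submodule.mkQ _)

/-- Alternating bilinear maps on `L` satisfying the Hom-Jacobi identity with respect to the bracket
of `L`. -/
structure IsExteriorPairing (f : L →ₗ[K] L →ₗ[K] M) : Prop where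
  self : ∀ x, f x x = 0
  jacobi : ∀ x y z, f (S.twist x) (S.bracket y z) + f (S.twist z) (S.bracket x y)
    + f (S.twist y) (S.bracket z x) = 0

theorem wedge_isExteriorPairing : S.IsExteriorPairing S.wedge := by
  have hself : ∀ x, S.wedge x x = 0 := fun x =>
    (Submodule.Quotient.mk_eq_zero _).mpr (Submodule.subset_span ⟨x, x, rfl, rfl⟩)
  have hskew : ∀ x y, S.wedge x y = - S.wedge y x := by
    intro x y
    have h := hself (x + y)
    simp only [map_add, LinearMap.add_apply, hself, zero_add, add_zero] at h
    exact eq_neg_of_add_eq_zero_right h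
  refine ⟨hself, fun x y z => ?_⟩
  have h : S.wedge (S.twist x) (S.bracket y z) - S.wedge (S.bracket z x) (S.twist y)
      + S.wedge (S.bracket y x) (S.twist z) = 0 := by
    -- Relation (b) alone yields the Hom-Jacobi identity, up to skew-symmetry.
    have hmem : S.twist x ⊗ₜ[K] S.bracket y z - S.bracket z x ⊗ₜ[K] S.twist y
        + S.bracket y x ⊗ₜ[K] S.twist z ∈ tensorRelations
          (S.idCrossedModule.inducedAction S.idCrossedModule.toAction)
          (S.idCrossedModule.inducedAction S.idCrossedModule.toAction) :=
      Submodule.subset_span (Or.inl (Or.inl (Or.inl (Or.inr ⟨x, y, z, rfl⟩))))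
    exact congrArg (box S.idCrossedModule S.idCrossedModule).mkQ
      ((Submodule.Quotient.mk_eq_zero _).mpr hmem)
  rw [hskew (S.bracket z x), hskew (S.bracket y x), S.skew y x, map_neg] at h
  rw [← h]
  abel

variable {S}

theorem IsExteriorPairing.skew {f : L →ₗ[K] L →ₗ[K] M} (hf : S.IsExteriorPairing f) (x y : L) :
    f x y = - f y x := by
  have h := hf.self (x + y)
  simp only [map_add, LinearMap.add_apply, hf.self, zero_add, add_zero] at h
  exact eq_neg_of_add_eq_zero_right h

theorem IsExteriorPairing.jacobi' {f : L →ₗ[K] L →ₗ[K] M} (hf : S.IsExteriorPairing f)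
    (x y z : L) : f (S.bracket x y) (S.twist z) + f (S.bracket y z) (S.twist x)
      + f (S.bracket z x) (S.twist y) = 0 := by
  rw [hf.skew (S.bracket x y), hf.skew (S.bracket y z), hf.skew (S.bracket z x),
    ← neg_eq_zero, ← hf.jacobi x y z]
  abel

/-- Families (a) and (b) are Hom-Jacobi up to signs. In (c) and (d) the actions are brackets, so
skew-symmetry and alternation suffice. Family (e) is Hom-Jacobi applied to three brackets. -/
theorem IsExteriorPairing.tensorRelations_le_ker {f : L →ₗ[K] L →ₗ[K] M}
    (hf : S.IsExteriorPairing f) :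
    tensorRelations (S.idCrossedModule.inducedAction S.idCrossedModule.toAction)
      (S.idCrossedModule.inducedAction S.idCrossedModule.toAction)
        ≤ LinearMap.ker (TensorProduct.lift f) := by
  refine Submodule.span_le.mpr ?_
  rintro t ((((⟨m, m', n, rfl⟩ | ⟨m, n, n', rfl⟩) | ⟨m, n, rfl⟩) | ⟨m, m', n, n', rfl⟩) |
    ⟨m, m', m'', n, n', n'', rfl⟩)
  · rw [SetLike.mem_coe, LinearMap.mem_ker, map_add, map_sub]
    change f (S.bracket m m') (S.twist n) - f (S.twist m) (S.bracket m' n)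
      + f (S.twist m') (S.bracket m n) = 0
    have h := hf.jacobi m m' n
    rw [hf.skew (S.twist n), S.skew n m, map_neg] at h
    rw [← neg_eq_zero, ← h]
    abel
  · rw [SetLike.mem_coe, LinearMap.mem_ker, map_add, map_sub]
    change f (S.twist m) (S.bracket n n') - f (S.bracket n' m) (S.twist n)
      + f (S.bracket n m) (S.twist n') = 0
    have h := hf.jacobi m n n'
    rw [hf.skew (S.bracket n' m), hf.skew (S.bracket n m), S.skew n m, map_neg, ← h]
    abel
  · change f (S.bracket n m) (S.bracket m n) = 0
    rw [S.skew n m, map_neg, LinearMap.neg_apply, hf.self, neg_zero]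
  · change f (S.bracket n m) (S.bracket m' n') + f (S.bracket n' m') (S.bracket m n) = 0
    rw [S.skew n m, S.skew n' m', hf.skew (-S.bracket m' n')]
    simp
  · change f (S.bracket (S.bracket n m) (S.bracket n' m')) (S.twist (S.bracket m'' n''))
      + f (S.bracket (S.bracket n' m') (S.bracket n'' m'')) (S.twist (S.bracket m n))
      + f (S.bracket (S.bracket n'' m'') (S.bracket n m)) (S.twist (S.bracket m' n')) = 0
    have h := hf.jacobi' (S.bracket n m) (S.bracket n' m') (S.bracket n'' m'')
    rw [S.skew m'' n'', S.skew m n, S.skew m' n']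
    simp only [map_neg]
    rw [← neg_eq_zero, ← h]
    abel

/-- The linear map on `L ⋏ L` induced by a pairing, `x ⋏ y ↦ f x y`. -/
def IsExteriorPairing.lift {f : L →ₗ[K] L →ₗ[K] M} (hf : S.IsExteriorPairing f) :
    S.ExteriorSquare →ₗ[K] M :=
  (box S.idCrossedModule S.idCrossedModule).liftQ
    (Submodule.liftQ _ (TensorProduct.lift f) hf.tensorRelations_le_ker) (by
      refine Submodule.span_le.mpr ?_
      rintro t ⟨m, n, hmn, rfl⟩
      -- Both crossed modules are the identity, so the box is spanned by the squares `m ⋆ m`.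
      obtain rfl : m = n := hmn
      exact hf.self m)

theorem IsExteriorPairing.lift_wedge {f : L →ₗ[K] L →ₗ[K] M} (hf : S.IsExteriorPairing f)
    (x y : L) : hf.lift (S.wedge x y) = f x y := rfl

theorem ExteriorSquare.hom_ext {g h : S.ExteriorSquare →ₗ[K] M}
    (hgh : ∀ x y, g (S.wedge x y) = h (S.wedge x y)) : g = h := by
  refine Submodule.linearMap_qext _ (Submodule.linearMap_qext _ (TensorProduct.ext' ?_))
  exact hgh

variable (S) in
theorem bracket_isExteriorPairing : S.IsExteriorPairing S.bracket :=
  ⟨S.bracket_self, S.hom_jacobi⟩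

theorem IsExteriorPairing.comp_twist {f : L →ₗ[K] L →ₗ[K] M} (hf : S.IsExteriorPairing f) :
    S.IsExteriorPairing (f.compl₁₂ S.twist S.twist) := by
  refine ⟨fun x => hf.self _, fun x y z => ?_⟩
  simp only [LinearMap.compl₁₂_apply, S.twist_bracket]
  exact hf.jacobi _ _ _

theorem IsExteriorPairing.comp {N : Type*} [AddCommGroup N] [Module K N]
    {f : L →ₗ[K] L →ₗ[K] M} (hf : S.IsExteriorPairing f) (g : M →ₗ[K] N) :
    S.IsExteriorPairing (f.compr₂ g) := by
  refine ⟨fun x => ?_, fun x y z => ?_⟩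
  · simp only [LinearMap.compr₂_apply, hf.self, map_zero]
  · simp only [LinearMap.compr₂_apply, ← map_add, hf.jacobi, map_zero]

/-- The commutator map `L ⋏ L → L`, `x ⋏ y ↦ [x, y]`. -/
def commutatorMap (S : HomLieAlgebra K L) : S.ExteriorSquare →ₗ[K] L :=
  S.bracket_isExteriorPairing.lift

/-- The map `x ⋏ y ↦ α(x) ⋏ α(y)`. -/
def wedgeTwist (S : HomLieAlgebra K L) : S.ExteriorSquare →ₗ[K] S.ExteriorSquare :=
  S.wedge_isExteriorPairing.comp_twist.lift

theorem commutatorMap_wedgeTwist (t : S.ExteriorSquare) :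
    S.commutatorMap (S.wedgeTwist t) = S.twist (S.commutatorMap t) := by
  have h : S.commutatorMap ∘ₗ S.wedgeTwist = S.twist ∘ₗ S.commutatorMap :=
    ExteriorSquare.hom_ext fun x y => (S.twist_bracket x y).symm
  exact LinearMap.congr_fun h t

theorem mem_exteriorCenter {l : L} :
    l ∈ S.exteriorCenter ↔ ∀ (k : ℕ) (x : L), S.wedge (S.twist^[k] l) x = 0 := Iff.rfl

theorem zero_mem_exteriorCenter : (0 : L) ∈ S.exteriorCenter := by
  refine mem_exteriorCenter.mpr fun k x => ?_
  rw [iterate_map_zero, map_zero, LinearMap.zero_apply]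

end ExteriorSquare

/-! ### Capable implies trivial exterior centre -/

section Quotient

variable {K L H : Type*} [Field K] [AddCommGroup L] [Module K L] [AddCommGroup H] [Module K H]
  {S : HomLieAlgebra K L}

theorem twist_iterate_map {T : HomLieAlgebra K H} {p : H →ₗ[K] L}
    (hp : ∀ h, p (T.twist h) = S.twist (p h)) (k : ℕ) (h : H) :
    p (T.twist^[k] h) = S.twist^[k] (p h) :=
  (show Function.Semiconj p T.twist S.twist from hp).iterate_right k h

theorem isomorphic_quotient {T : HomLieAlgebra K H} (I : T.Ideal) (p : H →ₗ[K] L)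
    (hsurj : Function.Surjective p) (hker : LinearMap.ker p = I.toSubmodule)
    (hbracket : ∀ x y, p (T.bracket x y) = S.bracket (p x) (p y))
    (htwist : ∀ x, p (T.twist x) = S.twist (p x)) : S.Isomorphic (T.quotient I) := by
  let e : (H ⧸ I.toSubmodule) ≃ₗ[K] L :=
    (Submodule.quotEquivOfEq _ _ hker.symm).trans (p.quotKerEquivOfSurjective hsurj)
  have he : ∀ h, e.symm (p h) = Submodule.Quotient.mk h := fun h =>
    e.symm_apply_eq.mpr rfl
  refine ⟨e.symm, fun x y => ?_, fun x => ?_⟩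
  · obtain ⟨x, rfl⟩ := hsurj x
    obtain ⟨y, rfl⟩ := hsurj y
    rw [← hbracket, he, he, he, quotient_bracket_mk]
  · obtain ⟨x, rfl⟩ := hsurj x
    rw [← htwist, he, he, quotient_twist_mk]

/-- The bracket of `H`, as a bilinear map on `H / Z(H)`. -/
def centralBracket (T : HomLieAlgebra K H) :
    (H ⧸ T.center.toSubmodule) →ₗ[K] (H ⧸ T.center.toSubmodule) →ₗ[K] H :=
  -- Only the case `k = 0` of centrality is needed to descend; skew-symmetry handles the second
  -- variable.
  T.center.toSubmodule.liftQ
    (LinearMap.flip (T.center.toSubmodule.liftQ (LinearMap.flip T.bracket) (by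
      intro y hy
      ext x
      simp only [LinearMap.flip_apply, LinearMap.zero_apply]
      rw [T.skew, neg_eq_zero]
      exact hy 0 x))) (by
    intro x hx
    ext y
    exact hx 0 y)

theorem centralBracket_mk (T : HomLieAlgebra K H) (x y : H) :
    T.centralBracket (Submodule.Quotient.mk x) (Submodule.Quotient.mk y) = T.bracket x y := rfl

theorem centralBracket_isExteriorPairing (T : HomLieAlgebra K H) :
    (T.quotient T.center).IsExteriorPairing T.centralBracket := by
  refine ⟨fun x => ?_, fun x y z => ?_⟩
  · obtain ⟨x, rfl⟩ := Submodule.Quotient.mk_surjective _ x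
    exact T.bracket_self x
  · obtain ⟨x, rfl⟩ := Submodule.Quotient.mk_surjective _ x
    obtain ⟨y, rfl⟩ := Submodule.Quotient.mk_surjective _ y
    obtain ⟨z, rfl⟩ := Submodule.Quotient.mk_surjective _ z
    exact T.hom_jacobi x y z

/-- Lifting the descended bracket to the exterior square turns each vanishing wedge into a vanishing
bracket in `H`. -/
theorem exteriorCenter_quotient_center (T : HomLieAlgebra K H) :
    (T.quotient T.center).exteriorCenter = {0} := by
  refine Set.Subset.antisymm (fun l hl => ?_)
    (Set.singleton_subset_iff.mpr zero_mem_exteriorCenter)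
  obtain ⟨h, rfl⟩ := Submodule.Quotient.mk_surjective _ l
  refine (Submodule.Quotient.mk_eq_zero _).mpr fun k y => ?_
  have hw := congrArg T.centralBracket_isExteriorPairing.lift
    (mem_exteriorCenter.mp hl k (Submodule.Quotient.mk y))
  have hk := twist_iterate_map (S := T.quotient T.center) (T := T)
    (p := T.center.toSubmodule.mkQ) (fun _ => rfl) k h
  rw [Submodule.mkQ_apply, Submodule.mkQ_apply] at hk
  rwa [IsExteriorPairing.lift_wedge, map_zero, ← hk, centralBracket_mk] at hw

theorem Isomorphic.exteriorCenter_eq {T : HomLieAlgebra K H} (hST : S.Isomorphic T)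
    (hT : T.exteriorCenter = {0}) : S.exteriorCenter = {0} := by
  obtain ⟨e, hbracket, htwist⟩ := hST
  -- Pulling the wedge of `T` back along `e` gives a map of exterior squares that transports
  -- vanishing.
  have hpair : S.IsExteriorPairing (T.wedge.compl₁₂ e.toLinearMap e.toLinearMap) := by
    refine ⟨fun x => T.wedge_isExteriorPairing.self _, fun x y z => ?_⟩
    simp only [LinearMap.compl₁₂_apply, LinearEquiv.coe_coe, hbracket, htwist]
    exact T.wedge_isExteriorPairing.jacobi _ _ _
  refine Set.Subset.antisymm (fun l hl => ?_)
    (Set.singleton_subset_iff.mpr zero_mem_exteriorCenter)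
  have hmem : e l ∈ T.exteriorCenter := by
    refine mem_exteriorCenter.mpr fun k y => ?_
    have hw := congrArg hpair.lift (mem_exteriorCenter.mp hl k (e.symm y))
    have hk := twist_iterate_map (S := T) (T := S) (p := e.toLinearMap) htwist k l
    rw [IsExteriorPairing.lift_wedge, map_zero, LinearMap.compl₁₂_apply, hk] at hw
    simpa using hw
  rw [hT] at hmem
  exact e.map_eq_zero_iff.mp hmem

end Quotient

/-! ### Trivial exterior centre implies capable -/

section Extension

variable {K L M : Type*} [Field K] [AddCommGroup L] [Module K L] [AddCommGroup M] [Module K M]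
  {S : HomLieAlgebra K L}

/-- Given a pairing `f : L × L → M` lifting the bracket of `L` through `c : M → L`, and a lift `τ`
of the twist to `M`, the Hom-Lie algebra `M × L` with
`[(s, x), (t, y)] = (f (c(s) + x) (c(t) + y), 0)` and twist `(τ, α)`.  It maps onto `L` by
`(s, x) ↦ c(s) + x`. -/
def extension {f : L →ₗ[K] L →ₗ[K] M} (hf : S.IsExteriorPairing f) (c : M →ₗ[K] L)
    (τ : M →ₗ[K] M) (hc : ∀ x y, c (f x y) = S.bracket x y)
    (hτ : ∀ x y, τ (f x y) = f (S.twist x) (S.twist y))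
    (hcτ : ∀ t, c (τ t) = S.twist (c t)) : HomLieAlgebra K (M × L) where
  bracket := (f.compl₁₂ (c.coprod LinearMap.id) (c.coprod LinearMap.id)).compr₂
    (LinearMap.inl K M L)
  twist := τ.prodMap S.twist
  bracket_self := fun _ => Prod.ext (hf.self _) rfl
  hom_jacobi := by
    intro x y z
    -- The bracket sees only images in `L`, and `c` sends `f` back to the bracket of `L`, so the
    -- identity is that of `f` at these images.
    have h := hf.jacobi (c x.1 + x.2) (c y.1 + y.2) (c z.1 + z.2)
    refine Prod.ext ?_ ?_
    · simpa [hc, hcτ] using h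
    · simp
  twist_bracket := by
    intro x y
    simp [hτ, hcτ]

theorem isomorphic_extension_quotient_center {f : L →ₗ[K] L →ₗ[K] M}
    (hf : S.IsExteriorPairing f) (c : M →ₗ[K] L)
    (τ : M →ₗ[K] M) (hc : ∀ x y, c (f x y) = S.bracket x y)
    (hτ : ∀ x y, τ (f x y) = f (S.twist x) (S.twist y))
    (hcτ : ∀ t, c (τ t) = S.twist (c t))
    (hcenter : ∀ l, (∀ (k : ℕ) (x : L), f (S.twist^[k] l) x = 0) → l = 0) :
    S.Isomorphic ((extension hf c τ hc hτ hcτ).quotient (extension hf c τ hc hτ hcτ).center) := by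
  have htwist : ∀ h, c.coprod LinearMap.id ((extension hf c τ hc hτ hcτ).twist h)
      = S.twist (c.coprod LinearMap.id h) := by
    intro h
    simp [extension, hcτ]
  have hbracket : ∀ x y, (extension hf c τ hc hτ hcτ).bracket x y
      = (f (c.coprod LinearMap.id x) (c.coprod LinearMap.id y), 0) := fun _ _ => rfl
  have hsurj : Function.Surjective (c.coprod (LinearMap.id : L →ₗ[K] L)) := fun x =>
    ⟨(0, x), by simp⟩
  refine isomorphic_quotient _ (c.coprod LinearMap.id) hsurj ?_ ?_ htwist
  · ext h
    refine LinearMap.mem_ker.trans ⟨fun hh k y => ?_, fun hh => hcenter _ fun k x => ?_⟩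
    · rw [hbracket, twist_iterate_map htwist, hh, iterate_map_zero, map_zero,
        LinearMap.zero_apply, Prod.mk_zero_zero]
    -- Surjectivity lets brackets with all of `M × L` test the image of `h` against all of `L`.
    · obtain ⟨y, rfl⟩ := hsurj x
      have h0 := hh k y
      rw [hbracket, twist_iterate_map htwist] at h0
      exact congrArg Prod.fst h0
  · intro x y
    rw [hbracket, LinearMap.coprod_apply, map_zero, add_zero, hc]

end Extension

end HomLieAlgebra

theorem mainTheorem1 {K : Type v} {L : Type u} [Field K] [AddCommGroup L] [Module K L]
    (S : HomLieAlgebra K L) :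
    HomLieAlgebra.Capable.{w} S ↔ S.exteriorCenter = {0} := by
  constructor
  · rintro ⟨H, _, _, T, hST⟩
    exact hST.exteriorCenter_eq T.exteriorCenter_quotient_center
  · intro hS
    -- The exterior square lives in universe `u`; lifting it places the extension in `max u w`.
    let ε : ULift.{w} S.ExteriorSquare ≃ₗ[K] S.ExteriorSquare := ULift.moduleEquiv
    refine ⟨ULift.{w} S.ExteriorSquare × L, inferInstance, inferInstance, _,
      HomLieAlgebra.isomorphic_extension_quotient_center
        (S.wedge_isExteriorPairing.comp ε.symm.toLinearMap)
        (S.commutatorMap ∘ₗ ε.toLinearMap)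
        (ε.symm.toLinearMap ∘ₗ S.wedgeTwist ∘ₗ ε.toLinearMap)
        (fun _ _ => rfl) (fun _ _ => rfl)
        (fun t => HomLieAlgebra.commutatorMap_wedgeTwist (ε t)) fun l hl => ?_⟩
    have hmem : l ∈ S.exteriorCenter := fun k x => ε.symm.map_eq_zero_iff.mp (hl k x)
    rwa [hS] at hmem
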